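/- Let $n\ge 2$ and $d\ge 1$ be integers and let $V_1,\dots,V_n$ be i.i.d. random vectors in $\mathbb{R}^d$. Write $[v]_j$ for the $j$-th coordinate of a vector $v$, let $\bar V:=\frac1n\sum_{i=1}^n V_i$, and let $\nu:=\mathbb{E}[V_i]$ (which exists under either boundedness assumption below). Then: 1. If $C$ is a constant with $\|V_i\|_2\le C$ almost surely for every $i$, then for all $\delta\in(0,1)$, $$\mathbb{P}\left(\|\bar V-\nu\|_2>\frac{2\sqrt{\sum_{i=1}^n\|V_i-\bar V\|_2^2\,\ln\frac6\delta}}{n}+\frac{10\,C\ln\frac6\delta}{n-1}\right)\le\delta .$$ 2. If $C_1,\dots,C_d$ are constants with $|[V_i]_j|\le C_j$ for all $j\in\{1,\dots,d\}$ almost surely, for every $i$, then for all $\delta\in(0,1)$, (a) $$\mathbb{P}\left(\|\bar V-\nu\|_\infty>\max_{1\le j\le d}\left(\frac{\sqrt{2\sum_{i=1}^n[V_i-\bar V]_j^2\,\ln\frac{4d}\delta}}{n-1}+\frac{14\,C_j\ln\frac{4d}\delta}{3(n-1)}\right)\right)\le\delta ,$$ (b) $$\mathbb{P}\left(\|\bar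 V-\nu\|_1>\sum_{j=1}^d\left(\frac{\frac94\sqrt{2\sum_{i=1}^n[V_i-\bar V]_j^2\,\ln\frac{30}\delta}}{n-1}+\frac{25\,C_j\ln\frac{30}\delta}{n-1}\right)\right)\le\delta .$$ -/

import Mathlib

open MeasureTheory ProbabilityTheory
open scoped ENNReal

noncomputable section

/-- The `ℓ_p` norm of a vector of `ℝ^d`. -/
def vecNorm {d : ℕ} (p : ℝ≥0∞) (x : Fin d → ℝ) : ℝ :=
  ‖(WithLp.toLp p x : PiLp p (fun _ : Fin d => ℝ))‖

/-- The sample mean `(1/n) ∑ i, V i` of random vectors `V 0, …, V (n-1)`. -/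
def sampleMean {Ω : Type*} {n d : ℕ} (V : Fin n → Ω → Fin d → ℝ) (ω : Ω) : Fin d → ℝ :=
  (1 / (n : ℝ)) • ∑ i, V i ω

end

/-! All three bounds come from one empirical Bernstein inequality in a Hilbert space,
`measure_sum_norm_mean_sub_gt_le`. Write `σ² = v` for the variance of one vector and `L` for the
logarithm. Two deviations are controlled: the norm of the centred sample mean exceeds `σ√(2L/n) +
2CL/(3n)`, or `σ` exceeds the sample standard deviation by `2C√(2L/(n-1))`. Each, divided by a
suitable scale, has exponential moment at most `2 exp(-L)`. Inserting the second bound into the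
first replaces `σ` by its estimate, at total probability `4 exp(-L)`.

The first moment bound is Bernstein's inequality for norms, free of the dimension: `cosh ‖·‖` grows
along an independent centred sum by a factor depending only on `‖h‖` (`cosh_norm_add_le`,
`integral_exp_norm_sum_le`). The second writes the sample variance as an average, over permutations,
of means over disjoint pairs; Jensen's inequality then reduces to products of independent factors
(`exp_neg_sampleVariance_le_average`, `integral_exp_neg_sampleVariance_le`).

Working with exponential moments rather than tails lets several coordinates be summed with no union
bound (`measure_sum_pos_le`), which makes the `ℓ₁` bound free of `d`. The `ℓ₂` bound is the case of
a single sample in Euclidean space; the `ℓ_∞` bound is a union bound over coordinates. -/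

/-! ### One-step bound for the hyperbolic cosine of a norm -/

theorem convexOn_cosh_sqrt : ConvexOn ℝ (Set.Ici 0) (fun u : ℝ => Real.cosh √u) := by
  -- As a power series in `u`, `cosh √u` has nonnegative coefficients, so convexity follows
  -- termwise.
  have key : ∀ u : ℝ, 0 ≤ u →
      HasSum (fun k : ℕ => u ^ k / ((2 * k).factorial : ℝ)) (Real.cosh √u) := by
    intro u hu
    have := Real.hasSum_cosh √u
    simpa only [pow_mul, Real.sq_sqrt hu] using this
  refine ⟨convex_Ici 0, fun u hu v hv a b ha hb hab => ?_⟩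
  have hu' : 0 ≤ u := hu
  have hv' : 0 ≤ v := hv
  simp only [smul_eq_mul]
  refine hasSum_le (fun k => ?_) (key (a * u + b * v) (by positivity))
    (((key u hu').mul_left a).add ((key v hv').mul_left b))
  have := (convexOn_pow k).2 hu hv ha hb hab
  simp only [smul_eq_mul] at this
  rw [mul_div_assoc', mul_div_assoc', ← add_div]
  gcongr

/-- The two sides differ by `(cosh a - sinh a) * (sinh b - b)`. -/
theorem cosh_add_le (a : ℝ) {b : ℝ} (hb : 0 ≤ b) :
    Real.cosh (a + b) ≤
      Real.cosh a + b * Real.sinh a + Real.cosh a * (Real.exp b - 1 - b) := by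
  have h1 := Real.self_le_sinh_iff.2 hb
  have h2 := (Real.sinh_lt_cosh a).le
  rw [Real.cosh_add, ← Real.cosh_add_sinh b]
  nlinarith [mul_le_mul_of_nonneg_right h2 (sub_nonneg.2 h1)]

theorem cosh_sub_le {a b : ℝ} (ha : 0 ≤ a) (hb : 0 ≤ b) :
    Real.cosh (a - b) ≤
      Real.cosh a - b * Real.sinh a + Real.cosh a * (Real.exp b - 1 - b) := by
  have h1 := Real.self_le_sinh_iff.2 hb
  have h2 := Real.sinh_nonneg_iff.2 ha
  have h3 := Real.cosh_pos a
  rw [Real.cosh_sub, ← Real.cosh_add_sinh b]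
  nlinarith [mul_nonneg h2 (sub_nonneg.2 h1), mul_nonneg h3.le (sub_nonneg.2 h1)]

/-- If `c` is the cosine of the angle between `x` and `h`, then `‖x + h‖²` is the convex combination
of `(‖x‖ + ‖h‖)²` and `(‖x‖ - ‖h‖)²` with weights `(1 ± c)/2`. Convexity of `cosh √·` thus reduces
the claim to the two collinear cases. The middle term is linear in `h`, so it vanishes in
expectation for a centred independent increment. -/
theorem cosh_norm_add_le {E : Type*} [NormedAddCommGroup E] [InnerProductSpace ℝ E] (x h : E) :
    Real.cosh ‖x + h‖ ≤ Real.cosh ‖x‖ + inner ℝ ((Real.sinh ‖x‖ / ‖x‖) • x) h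
      + Real.cosh ‖x‖ * (Real.exp ‖h‖ - 1 - ‖h‖) := by
  rcases eq_or_ne x 0 with rfl | hx
  · have := cosh_add_le 0 (norm_nonneg h)
    simpa using this
  rcases eq_or_ne h 0 with rfl | hh
  · simp
  have ha : 0 < ‖x‖ := norm_pos_iff.2 hx
  have hb : 0 < ‖h‖ := norm_pos_iff.2 hh
  set a := ‖x‖
  set b := ‖h‖
  obtain ⟨c, hc⟩ : ∃ c, inner ℝ x h = a * b * c := ⟨inner ℝ x h / (a * b), by field_simp⟩
  have hcs := abs_le.1 (abs_real_inner_le_norm x h)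
  rw [hc] at hcs
  have hab : 0 < a * b := mul_pos ha hb
  have hc1 : c ≤ 1 := by nlinarith [hcs.2]
  have hc2 : -1 ≤ c := by nlinarith [hcs.1]
  have hn : ‖x + h‖ = √((1 + c) / 2 * (a + b) ^ 2 + (1 - c) / 2 * (a - b) ^ 2) := by
    have h2 := norm_add_sq_real x h
    rw [show (1 + c) / 2 * (a + b) ^ 2 + (1 - c) / 2 * (a - b) ^ 2 = ‖x + h‖ ^ 2 by
      rw [h2, hc]; ring, Real.sqrt_sq (norm_nonneg _)]
  have hconv := convexOn_cosh_sqrt.2 (Set.mem_Ici.2 (sq_nonneg (a + b)))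
    (Set.mem_Ici.2 (sq_nonneg (a - b))) (show 0 ≤ (1 + c) / 2 by linarith)
    (show 0 ≤ (1 - c) / 2 by linarith) (by ring)
  simp only [smul_eq_mul, Real.sqrt_sq_eq_abs, Real.cosh_abs] at hconv
  rw [← hn] at hconv
  have e1 := mul_le_mul_of_nonneg_left (cosh_add_le a hb.le)
    (show 0 ≤ (1 + c) / 2 by linarith)
  have e2 := mul_le_mul_of_nonneg_left (cosh_sub_le ha.le hb.le)
    (show 0 ≤ (1 - c) / 2 by linarith)
  have e3 : inner ℝ ((Real.sinh a / a) • x) h = Real.sinh a * b * c := by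
    rw [real_inner_smul_left, hc]
    field_simp
  rw [e3]
  linarith

/-! ### Scalar inequalities for the exponential -/

/-- Since `(k+2)! ≥ 2 * 3^k`, the tail of the exponential series is dominated by a geometric series
of ratio `x/3`. -/
theorem exp_sub_one_sub_le {x : ℝ} (hx : 0 ≤ x) (hx3 : x < 3) :
    Real.exp x - 1 - x ≤ x ^ 2 / (2 * (1 - x / 3)) := by
  have h3 : |x / 3| < 1 := by rw [abs_of_nonneg (by positivity)]; linarith
  have hg := ((hasSum_geometric_of_abs_lt_one h3).mul_left (x ^ 2 / 2))
  have he : HasSum (fun k : ℕ => x ^ k / (k.factorial : ℝ)) (Real.exp x) := by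
    rw [Real.exp_eq_exp_ℝ]; exact NormedSpace.expSeries_div_hasSum_exp x
  have he2 := (hasSum_nat_add_iff' 2).2 he
  have e : Real.exp x - ∑ i ∈ Finset.range 2, x ^ i / (i.factorial : ℝ)
      = Real.exp x - 1 - x := by simp [Finset.sum_range_succ]; ring
  rw [e] at he2
  have hle := hasSum_le (fun k => ?_) he2 hg
  · refine hle.trans (le_of_eq ?_)
    rw [div_mul_eq_div_div, div_eq_mul_inv (x ^ 2 / 2)]
  · have hf : (2 * 3 ^ k : ℝ) ≤ ((k + 2).factorial : ℝ) := by
      have := Nat.factorial_mul_pow_le_factorial (m := 2) (n := k)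
      rw [add_comm k 2]
      exact_mod_cast (by simpa using this)
    rw [div_pow, div_mul_div_comm, ← pow_add, add_comm 2 k]
    gcongr

theorem exp_neg_le_quadratic {x : ℝ} (hx : 0 ≤ x) : Real.exp (-x) ≤ 1 - x + x ^ 2 / 2 := by
  have h1 := Real.quadratic_le_exp_of_nonneg hx
  rw [Real.exp_neg, inv_le_comm₀ (Real.exp_pos _) (by nlinarith [sq_nonneg (x - 1)])]
  refine le_trans ?_ h1
  rw [inv_le_iff_one_le_mul₀ (by nlinarith [sq_nonneg (x - 1)])]
  -- `(1 - x + x²/2)(1 + x + x²/2) = 1 + x⁴/4`.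
  nlinarith [sq_nonneg (x ^ 2)]

/-- Trades `√u` for `u`, whose exponential moment is accessible: for `√u ≤ σ` the chord `u/σ` lies
below `√u`, and otherwise the left side is at most `1`. -/
theorem exp_sub_sqrt_le {θ σ u : ℝ} (hθ : 0 ≤ θ) (hσ : 0 < σ) (hu : 0 ≤ u) :
    Real.exp (θ * (σ - √u)) ≤ 1 + Real.exp (θ * σ) * Real.exp (-(θ / σ * u)) := by
  rw [← Real.exp_add]
  rcases le_total σ √u with h | h
  · have : Real.exp (θ * (σ - √u)) ≤ 1 := Real.exp_le_one_iff.2 (by nlinarith)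
    linarith [Real.exp_pos (θ * σ + -(θ / σ * u))]
  · have h2 : θ * (σ - √u) ≤ θ * σ + -(θ / σ * u) := by
      have : θ / σ * u ≤ θ * √u := by
        rw [div_mul_eq_mul_div, mul_div_assoc]
        gcongr
        rw [div_le_iff₀ hσ]
        nlinarith [Real.mul_self_sqrt hu, Real.sqrt_nonneg u]
      linarith
    linarith [Real.exp_le_exp.2 h2]

/-! ### Sample variance through pairs and permutations -/

theorem sum_sum_norm_sub_sq {E ι : Type*} [NormedAddCommGroup E] [InnerProductSpace ℝ E]
    [Fintype ι] [Nonempty ι] (x : ι → E) :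
    ∑ i, ∑ j, ‖x i - x j‖ ^ 2 =
      2 * Fintype.card ι * ∑ i, ‖x i - (1 / (Fintype.card ι : ℝ)) • ∑ k, x k‖ ^ 2 := by
  set N : ℝ := (Fintype.card ι : ℝ) with hNdef
  set M := (1 / N) • ∑ k, x k
  have hN : N ≠ 0 := by simp [N]
  have h0 : ∑ i, (x i - M) = 0 := by
    rw [Finset.sum_sub_distrib, Finset.sum_const, Finset.card_univ, ← Nat.cast_smul_eq_nsmul ℝ,
      ← hNdef, smul_smul, mul_one_div_cancel hN, one_smul, sub_self]
  have h1 : ∀ i j, ‖x i - x j‖ ^ 2 =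
      ‖x i - M‖ ^ 2 - 2 * inner ℝ (x i - M) (x j - M) + ‖x j - M‖ ^ 2 := fun i j => by
    rw [← norm_sub_sq_real, sub_sub_sub_cancel_right]
  simp only [h1, Finset.sum_add_distrib, Finset.sum_sub_distrib, ← Finset.mul_sum, ← inner_sum, h0,
    inner_zero_right, Finset.sum_const, Finset.card_univ, nsmul_eq_mul]
  ring

/-- The symmetric group is 2-transitive, so the sum over permutations is the same for every ordered
pair of distinct indices; the vanishing diagonal allows summing over all pairs. -/
theorem sum_perm_apply_pair {ι : Type*} [Fintype ι] [DecidableEq ι] (g : ι → ι → ℝ)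
    (hg : ∀ i, g i i = 0) {i j : ι} (hij : i ≠ j) :
    (Fintype.card ι : ℝ) * (Fintype.card ι - 1) * ∑ σ : Equiv.Perm ι, g (σ i) (σ j) =
      (Fintype.card (Equiv.Perm ι) : ℝ) * ∑ k, ∑ l, g k l := by
  have hconst : ∀ k l : ι, k ≠ l →
      ∑ σ : Equiv.Perm ι, g (σ k) (σ l) = ∑ σ : Equiv.Perm ι, g (σ i) (σ j) := by
    intro k l hkl
    obtain ⟨τ, h1, h2⟩ : ∃ τ : Equiv.Perm ι, τ k = i ∧ τ l = j := by
      have := (MulAction.is_two_pretransitive_iff (G := Equiv.Perm ι) (α := ι)).1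
        (Equiv.Perm.isMultiplyPretransitive ι 2) hkl hij
      simpa using this
    rw [← Equiv.sum_comp (Equiv.mulRight τ)]
    simp [h1, h2]
  have hswap : ∑ k, ∑ l, ∑ σ : Equiv.Perm ι, g (σ k) (σ l) =
      (Fintype.card (Equiv.Perm ι) : ℝ) * ∑ k, ∑ l, g k l := by
    calc _ = ∑ σ : Equiv.Perm ι, ∑ k, ∑ l, g (σ k) (σ l) := by
          rw [Finset.sum_comm (s := (Finset.univ : Finset (Equiv.Perm ι)))]
          exact Finset.sum_congr rfl fun k _ => Finset.sum_comm
      _ = ∑ σ : Equiv.Perm ι, ∑ k, ∑ l, g k l := by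
          refine Finset.sum_congr rfl fun σ _ => ?_
          rw [Equiv.sum_comp σ (fun k => ∑ l, g k (σ l))]
          exact Finset.sum_congr rfl fun k _ => Equiv.sum_comp σ (g k)
      _ = _ := by simp
  rw [← hswap]
  have hrow : ∀ k, ∑ l, ∑ σ : Equiv.Perm ι, g (σ k) (σ l) =
      (Fintype.card ι - 1) * ∑ σ : Equiv.Perm ι, g (σ i) (σ j) := by
    intro k
    rw [← Finset.add_sum_erase _ _ (Finset.mem_univ k)]
    rw [Finset.sum_congr rfl fun l hl => hconst k l (Finset.ne_of_mem_erase hl).symm]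
    simp only [hg, Finset.sum_const_zero, zero_add, Finset.sum_const, nsmul_eq_mul]
    rw [Finset.card_erase_of_mem (Finset.mem_univ k), Finset.card_univ,
      Nat.cast_pred (Fintype.card_pos_iff.2 ⟨k⟩)]
  simp only [hrow, Finset.sum_const, Finset.card_univ, nsmul_eq_mul]
  ring

/-! ### Exponential moments of sums and products -/

section
variable {Ω : Type*} [MeasurableSpace Ω] {μ : Measure Ω} [IsProbabilityMeasure μ]
  {E : Type*} [NormedAddCommGroup E] [InnerProductSpace ℝ E] [CompleteSpace E]
  [MeasurableSpace E] [BorelSpace E] [SecondCountableTopology E]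

/-- Each new summand costs a factor `1 + κ`: in `cosh_norm_add_le` the linear term integrates to
zero and the last term factors by independence. -/
theorem integral_cosh_norm_sum_le {ι : Type*} {W : ι → Ω → E} {K κ : ℝ}
    (hmeas : ∀ i, Measurable (W i)) (hindep : iIndepFun W μ)
    (hK : ∀ i, ∀ᵐ ω ∂μ, ‖W i ω‖ ≤ K) (hmean : ∀ i, ∫ ω, W i ω ∂μ = 0)
    (hκ : ∀ i, ∫ ω, (Real.exp ‖W i ω‖ - 1 - ‖W i ω‖) ∂μ ≤ κ) (hκ0 : 0 ≤ κ) (s : Finset ι) :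
    ∫ ω, Real.cosh ‖∑ i ∈ s, W i ω‖ ∂μ ≤ (1 + κ) ^ s.card := by
  classical
  have hbound : ∀ t : Finset ι, ∀ᵐ ω ∂μ, ‖∑ i ∈ t, W i ω‖ ≤ t.card * K := by
    intro t
    filter_upwards [(Finset.eventually_all t).2 fun i _ => hK i] with ω hω
    calc _ ≤ ∑ i ∈ t, ‖W i ω‖ := norm_sum_le _ _
      _ ≤ ∑ i ∈ t, K := Finset.sum_le_sum hω
      _ = _ := by simp
  have hint : ∀ t : Finset ι, Integrable (fun ω => Real.cosh ‖∑ i ∈ t, W i ω‖) μ := by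
    intro t
    refine Integrable.of_bound (C := Real.cosh (t.card * K)) (by fun_prop) ?_
    filter_upwards [hbound t] with ω hω
    rw [Real.norm_of_nonneg (Real.cosh_pos _).le, Real.cosh_le_cosh, abs_of_nonneg (norm_nonneg _)]
    exact hω.trans (le_abs_self _)
  induction s using Finset.induction_on with
  | empty => simp
  | insert a s ha ih =>
    have hS : Measurable (fun ω => ∑ i ∈ s, W i ω) := by fun_prop
    have hI : IndepFun (fun ω => ∑ i ∈ s, W i ω) (W a) μ := by
      have := hindep.indepFun_finsetSum_of_notMem hmeas ha
      convert this using 1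
      ext ω
      simp
    have hg : Measurable (fun x : E => (Real.sinh ‖x‖ / ‖x‖) • x) := by fun_prop
    have hgint : Integrable (fun ω => (Real.sinh ‖∑ i ∈ s, W i ω‖ / ‖∑ i ∈ s, W i ω‖) •
        ∑ i ∈ s, W i ω) μ := by
      refine Integrable.mono' (hint s) (hg.comp hS).aestronglyMeasurable (ae_of_all _ fun ω => ?_)
      set x := ∑ i ∈ s, W i ω
      rw [norm_smul, norm_div, norm_norm,
        Real.norm_of_nonneg (Real.sinh_nonneg_iff.2 (norm_nonneg _))]
      rcases eq_or_ne ‖x‖ 0 with h | h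
      · rw [h]; simp
      · rw [div_mul_cancel₀ _ h]
        exact (Real.sinh_lt_cosh _).le
    have hWint : Integrable (W a) μ := Integrable.of_bound (hmeas a).aestronglyMeasurable K (hK a)
    have hφ : Integrable (fun ω => Real.exp ‖W a ω‖ - 1 - ‖W a ω‖) μ := by
      refine ((Integrable.of_bound (C := Real.exp K) (by fun_prop) ?_).sub
        (integrable_const 1)).sub hWint.norm
      filter_upwards [hK a] with ω hω
      rw [Real.norm_of_nonneg (Real.exp_pos _).le]
      exact Real.exp_le_exp.2 hω
    have hI1 : IndepFun (fun ω => (Real.sinh ‖∑ i ∈ s, W i ω‖ / ‖∑ i ∈ s, W i ω‖) •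
        ∑ i ∈ s, W i ω) (W a) μ := hI.comp hg measurable_id
    have hI2 : IndepFun (fun ω => Real.cosh ‖∑ i ∈ s, W i ω‖)
        (fun ω => Real.exp ‖W a ω‖ - 1 - ‖W a ω‖) μ :=
      hI.comp (φ := fun x => Real.cosh ‖x‖) (ψ := fun x => Real.exp ‖x‖ - 1 - ‖x‖)
        (by fun_prop) (by fun_prop)
    have e1 : ∫ ω, inner ℝ ((Real.sinh ‖∑ i ∈ s, W i ω‖ / ‖∑ i ∈ s, W i ω‖) •
        ∑ i ∈ s, W i ω) (W a ω) ∂μ = 0 := by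
      have := hI1.integral_bilin hgint hWint (innerSL ℝ)
      rw [hmean a, map_zero] at this
      exact this
    have i1 : Integrable (fun ω => inner ℝ ((Real.sinh ‖∑ i ∈ s, W i ω‖ / ‖∑ i ∈ s, W i ω‖) •
        ∑ i ∈ s, W i ω) (W a ω)) μ := hI1.integrable_bilin hgint hWint (innerSL ℝ)
    have e2 := hI2.integral_fun_mul_eq_mul_integral (hint s).aestronglyMeasurable
      hφ.aestronglyMeasurable
    have i2 : Integrable (fun ω => Real.cosh ‖∑ i ∈ s, W i ω‖ *
        (Real.exp ‖W a ω‖ - 1 - ‖W a ω‖)) μ := hI2.integrable_mul (hint s) hφ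
    calc ∫ ω, Real.cosh ‖∑ i ∈ insert a s, W i ω‖ ∂μ
        ≤ ∫ ω, (Real.cosh ‖∑ i ∈ s, W i ω‖ +
            inner ℝ ((Real.sinh ‖∑ i ∈ s, W i ω‖ / ‖∑ i ∈ s, W i ω‖) • ∑ i ∈ s, W i ω) (W a ω)
            + Real.cosh ‖∑ i ∈ s, W i ω‖ * (Real.exp ‖W a ω‖ - 1 - ‖W a ω‖)) ∂μ := by
          refine integral_mono (hint _) (((hint s).add i1).add i2) fun ω => ?_
          simp only [Finset.sum_insert ha, add_comm (W a ω)]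
          exact cosh_norm_add_le _ _
      _ = (∫ ω, Real.cosh ‖∑ i ∈ s, W i ω‖ ∂μ) * (1 + ∫ ω, (Real.exp ‖W a ω‖ - 1 - ‖W a ω‖) ∂μ) := by
          rw [integral_add (by exact (hint s).add i1) i2, integral_add (hint s) i1, e1, e2]
          ring
      _ ≤ (1 + κ) ^ s.card * (1 + κ) := by
          refine mul_le_mul ih (by linarith [hκ a]) ?_ (by positivity)
          have : 0 ≤ ∫ ω, (Real.exp ‖W a ω‖ - 1 - ‖W a ω‖) ∂μ :=
            integral_nonneg fun ω => by
              have := Real.add_one_le_exp ‖W a ω‖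
              simp only [Pi.zero_apply]; linarith
          linarith
      _ = _ := by rw [Finset.card_insert_of_notMem ha, pow_succ]

/-- Bernstein's bound on the exponential moment of the norm of a sum of centered independent
vectors. -/
theorem integral_exp_norm_sum_le {ι : Type*} [Fintype ι] {X : ι → Ω → E} {b v lam : ℝ}
    (hmeas : ∀ i, Measurable (X i)) (hindep : iIndepFun X μ)
    (hb : ∀ i, ∀ᵐ ω ∂μ, ‖X i ω‖ ≤ b) (hmean : ∀ i, ∫ ω, X i ω ∂μ = 0)
    (hv : ∀ i, ∫ ω, ‖X i ω‖ ^ 2 ∂μ = v) (hlam : 0 ≤ lam) (hlb : lam * b < 3) (hv0 : 0 ≤ v) :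
    ∫ ω, Real.exp (lam * ‖∑ i, X i ω‖) ∂μ ≤
      2 * Real.exp (Fintype.card ι * (lam ^ 2 * v / (2 * (1 - lam * b / 3)))) := by
  have hden : 0 < 2 * (1 - lam * b / 3) := by linarith
  have hκ0 : 0 ≤ lam ^ 2 * v / (2 * (1 - lam * b / 3)) := by positivity
  have hXint : ∀ i, Integrable (X i) μ := fun i =>
    Integrable.of_bound (hmeas i).aestronglyMeasurable b (hb i)
  have hsq : ∀ i, Integrable (fun ω => ‖X i ω‖ ^ 2) μ := fun i => by
    refine Integrable.of_bound (by fun_prop) (b ^ 2) ?_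
    filter_upwards [hb i] with ω hω
    rw [norm_pow, norm_norm]
    gcongr
  have hWb : ∀ i, ∀ᵐ ω ∂μ, ‖lam • X i ω‖ ≤ lam * b := fun i => by
    filter_upwards [hb i] with ω hω
    rw [norm_smul, Real.norm_of_nonneg hlam]
    gcongr
  have main := integral_cosh_norm_sum_le (μ := μ) (W := fun i ω => lam • X i ω) (K := lam * b)
    (κ := lam ^ 2 * v / (2 * (1 - lam * b / 3))) (fun i => (hmeas i).const_smul lam)
    (hindep.comp (fun _ x => lam • x) fun _ => by fun_prop)
    hWb (fun i => by rw [integral_smul, hmean i, smul_zero]) (fun i => ?_) hκ0 Finset.univ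
  · have hle : ∀ ω, Real.exp (lam * ‖∑ i, X i ω‖) ≤ 2 * Real.cosh ‖∑ i, lam • X i ω‖ := fun ω => by
      rw [← Finset.smul_sum, norm_smul, Real.norm_of_nonneg hlam, Real.cosh_eq]
      linarith [Real.exp_pos (-(lam * ‖∑ i, X i ω‖))]
    have hintc : Integrable (fun ω => Real.cosh ‖∑ i, lam • X i ω‖) μ := by
      refine Integrable.of_bound (C := Real.cosh (Fintype.card ι * (lam * b))) (by fun_prop) ?_
      filter_upwards [ae_all_iff.2 hWb] with ω hω
      rw [Real.norm_of_nonneg (Real.cosh_pos _).le, Real.cosh_le_cosh,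
        abs_of_nonneg (norm_nonneg _)]
      refine (le_trans ?_ (le_abs_self _))
      calc _ ≤ ∑ i, ‖lam • X i ω‖ := norm_sum_le _ _
        _ ≤ ∑ _i : ι, lam * b := Finset.sum_le_sum fun i _ => hω i
        _ = _ := by simp
    calc _ ≤ ∫ ω, 2 * Real.cosh ‖∑ i, lam • X i ω‖ ∂μ :=
          integral_mono_of_nonneg (ae_of_all _ fun ω => (Real.exp_pos _).le)
            (hintc.const_mul 2) (ae_of_all _ hle)
      _ = 2 * ∫ ω, Real.cosh ‖∑ i, lam • X i ω‖ ∂μ := integral_const_mul _ _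
      _ ≤ _ := by
          gcongr
          refine main.trans ?_
          rw [Finset.card_univ, Real.exp_nat_mul]
          gcongr
          rw [add_comm]
          exact Real.add_one_le_exp _
  · have hpt : ∀ᵐ ω ∂μ, Real.exp ‖lam • X i ω‖ - 1 - ‖lam • X i ω‖ ≤
        lam ^ 2 / (2 * (1 - lam * b / 3)) * ‖X i ω‖ ^ 2 := by
      filter_upwards [hWb i] with ω hω
      refine (exp_sub_one_sub_le (norm_nonneg _) (hω.trans_lt hlb)).trans ?_
      rw [div_mul_eq_mul_div, ← mul_pow]
      have e : ‖lam • X i ω‖ = lam * ‖X i ω‖ := by rw [norm_smul, Real.norm_of_nonneg hlam]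
      rw [← e]
      gcongr
    refine (integral_mono_of_nonneg (ae_of_all _ fun ω => ?_) ((hsq i).const_mul _) hpt).trans ?_
    · have := Real.add_one_le_exp ‖lam • X i ω‖
      simp only [Pi.zero_apply]; linarith
    · rw [integral_const_mul, hv i, div_mul_eq_mul_div]

theorem integral_prod_pairs {κ F : Type*} [MeasurableSpace F] {W : κ × Bool → Ω → F}
    (hmeas : ∀ p, Measurable (W p)) (hindep : iIndepFun W μ)
    {f : F → F → ℝ} (hf : Measurable (Function.uncurry f)) (T : Finset κ) :
    ∫ ω, ∏ k ∈ T, f (W (k, true) ω) (W (k, false) ω) ∂μ =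
      ∏ k ∈ T, ∫ ω, f (W (k, true) ω) (W (k, false) ω) ∂μ := by
  classical
  induction T using Finset.induction_on with
  | empty => simp
  | insert a T ha ih =>
    have hm : ∀ k, Measurable fun ω => f (W (k, true) ω) (W (k, false) ω) := fun k =>
      hf.comp ((hmeas _).prodMk (hmeas _))
    have hdisj : Disjoint ({a} ×ˢ Finset.univ : Finset (κ × Bool)) (T ×ˢ Finset.univ) :=
      Finset.disjoint_product.2 (Or.inl (Finset.disjoint_singleton_left.2 ha))
    have h := hindep.indepFun_finset _ _ hdisj hmeas
    have ma : ∀ c, (a, c) ∈ ({a} ×ˢ Finset.univ : Finset (κ × Bool)) := fun c => by simp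
    have mT : ∀ (k : T) c, (k.1, c) ∈ (T ×ˢ Finset.univ : Finset (κ × Bool)) := fun k c => by simp
    have hφ : Measurable fun z : ↥({a} ×ˢ Finset.univ : Finset (κ × Bool)) → F =>
        f (z ⟨(a, true), ma true⟩) (z ⟨(a, false), ma false⟩) :=
      hf.comp (f := fun z : ↥({a} ×ˢ Finset.univ : Finset (κ × Bool)) → F =>
        (z ⟨(a, true), ma true⟩, z ⟨(a, false), ma false⟩))
        ((measurable_pi_apply _).prodMk (measurable_pi_apply _))
    have hψ : Measurable fun z : ↥(T ×ˢ Finset.univ : Finset (κ × Bool)) → F =>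
        ∏ k ∈ T.attach, f (z ⟨(k.1, true), mT k true⟩) (z ⟨(k.1, false), mT k false⟩) :=
      Finset.measurable_prod _ fun k _ =>
        hf.comp (f := fun z : ↥(T ×ˢ Finset.univ : Finset (κ × Bool)) → F =>
          (z ⟨(k.1, true), mT k true⟩, z ⟨(k.1, false), mT k false⟩))
          ((measurable_pi_apply _).prodMk (measurable_pi_apply _))
    have h2 := h.comp hφ hψ
    have h3 : IndepFun (fun ω => f (W (a, true) ω) (W (a, false) ω))
        (fun ω => ∏ k ∈ T, f (W (k, true) ω) (W (k, false) ω)) μ := by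
      convert h2 using 1
      · rfl
      ext ω
      exact (Finset.prod_attach T fun k => f (W (k, true) ω) (W (k, false) ω)).symm
    simp only [Finset.prod_insert ha]
    rw [h3.integral_fun_mul_eq_mul_integral (hm a).aestronglyMeasurable
      (Finset.measurable_prod _ fun k _ => hm k).aestronglyMeasurable, ih]

/-- Jensen and Markov: deviations controlled in exponential moments add up without loss in the
probability. -/
theorem measure_sum_pos_le {ι : Type*} (s : Finset ι) {Z : ι → Ω → ℝ} {Λ : ι → ℝ} {p : ℝ}
    (hΛ : ∀ j ∈ s, 0 < Λ j) (hint : ∀ j ∈ s, Integrable (fun ω => Real.exp (Z j ω / Λ j)) μ)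
    (hp : ∀ j ∈ s, ∫ ω, Real.exp (Z j ω / Λ j) ∂μ ≤ p) :
    μ {ω | 0 < ∑ j ∈ s, Z j ω} ≤ ENNReal.ofReal p := by
  rcases s.eq_empty_or_nonempty with rfl | hs
  · simp
  set A := ∑ j ∈ s, Λ j
  have hA : 0 < A := Finset.sum_pos hΛ hs
  have hw : ∑ j ∈ s, Λ j / A = 1 := by rw [← Finset.sum_div, div_self hA.ne']
  -- The weights `Λ j / A` undo the individual scales: the weighted mean of the exponents is `(∑ Z
  -- j) / A`, so the scales may differ from one `j` to another.
  set G : Ω → ℝ := fun ω => ∑ j ∈ s, Λ j / A * Real.exp (Z j ω / Λ j)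
  have hG0 : ∀ ω, 0 ≤ G ω := fun ω => Finset.sum_nonneg fun j hj =>
    mul_nonneg (div_nonneg (hΛ j hj).le hA.le) (Real.exp_pos _).le
  have hGint : Integrable G μ := integrable_finsetSum _ fun j hj => (hint j hj).const_mul _
  have hGle : ∫ ω, G ω ∂μ ≤ p := by
    rw [integral_finsetSum _ fun j hj => (hint j hj).const_mul _]
    calc _ = ∑ j ∈ s, Λ j / A * ∫ ω, Real.exp (Z j ω / Λ j) ∂μ :=
          Finset.sum_congr rfl fun j _ => integral_const_mul _ _
      _ ≤ ∑ j ∈ s, Λ j / A * p := Finset.sum_le_sum fun j hj =>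
          mul_le_mul_of_nonneg_left (hp j hj) (div_nonneg (hΛ j hj).le hA.le)
      _ = p := by rw [← Finset.sum_mul, hw, one_mul]
  have hsub : {ω | 0 < ∑ j ∈ s, Z j ω} ⊆ {ω | 1 ≤ G ω} := by
    intro ω hω
    have hω' : 0 < ∑ j ∈ s, Z j ω := hω
    have hj := convexOn_exp.map_sum_le (t := s) (w := fun j => Λ j / A)
      (p := fun j => Z j ω / Λ j) (fun j hj => div_nonneg (hΛ j hj).le hA.le) hw
      (fun _ _ => Set.mem_univ _)
    simp only [smul_eq_mul] at hj
    have e : ∑ j ∈ s, Λ j / A * (Z j ω / Λ j) = (∑ j ∈ s, Z j ω) / A := by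
      rw [Finset.sum_div]
      refine Finset.sum_congr rfl fun j hj => ?_
      have := (hΛ j hj).ne'
      field_simp
    rw [e] at hj
    exact le_trans (Real.one_le_exp (by positivity)) hj
  refine (measure_mono hsub).trans ?_
  have hmk := mul_meas_ge_le_integral_of_nonneg (ae_of_all _ hG0) hGint 1
  rw [one_mul] at hmk
  rw [ENNReal.le_ofReal_iff_toReal_le (measure_ne_top _ _)
    ((integral_nonneg hG0).trans hGle)]
  exact hmk.trans hGle

end

/-! ### Lower tail of the sample variance -/

/-- Hoeffding's representation of the sample variance as an average over permutations of sums over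
disjoint pairs, combined with Jensen's inequality. -/
theorem exp_neg_sampleVariance_le_average {E : Type*} [NormedAddCommGroup E]
    [InnerProductSpace ℝ E] {n : ℕ} (hn : 2 ≤ n) {κ : Type*} [Fintype κ]
    (e : κ × Bool ↪ Fin n) (x : Fin n → E) (τ : ℝ) :
    Real.exp (-(τ * (Fintype.card κ *
        ((∑ i, ‖x i - (1 / (n : ℝ)) • ∑ k, x k‖ ^ 2) / ((n : ℝ) - 1))))) ≤
      ∑ σ : Equiv.Perm (Fin n), 1 / (Fintype.card (Equiv.Perm (Fin n)) : ℝ) *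
        ∏ k : κ, Real.exp (-(τ * (‖x (σ (e (k, true))) - x (σ (e (k, false)))‖ ^ 2 / 2))) := by
  have hn1 : (0 : ℝ) < (n : ℝ) - 1 := by
    have : (2 : ℝ) ≤ n := by exact_mod_cast hn
    linarith
  have hn0 : (0 : ℝ) < n := by linarith
  have : Nonempty (Fin n) := ⟨⟨0, by omega⟩⟩
  obtain ⟨N, hN⟩ : ∃ N : ℝ, N = (Fintype.card (Equiv.Perm (Fin n)) : ℝ) := ⟨_, rfl⟩
  have hNpos : 0 < N := by rw [hN, Nat.cast_pos]; exact Fintype.card_pos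
  rw [← hN]
  have hj := convexOn_exp.map_sum_le (t := Finset.univ) (w := fun _ : Equiv.Perm (Fin n) => 1 / N)
    (p := fun σ => ∑ k, -(τ * (‖x (σ (e (k, true))) - x (σ (e (k, false)))‖ ^ 2 / 2)))
    (fun _ _ => by positivity) (by
      rw [Finset.sum_const, Finset.card_univ, nsmul_eq_mul, ← hN, mul_one_div_cancel hNpos.ne'])
    (fun _ _ => Set.mem_univ _)
  simp only [smul_eq_mul] at hj
  simp only [← Real.exp_sum]
  refine le_trans (le_of_eq ?_) hj
  congr 1
  rw [← Finset.mul_sum, Finset.sum_comm]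
  -- Every single pair, averaged over all permutations, already gives the sample variance.
  have hk : ∀ k : κ, ∑ σ : Equiv.Perm (Fin n),
      -(τ * (‖x (σ (e (k, true))) - x (σ (e (k, false)))‖ ^ 2 / 2)) =
      N * -(τ * ((∑ i, ‖x i - (1 / (n : ℝ)) • ∑ k, x k‖ ^ 2) / ((n : ℝ) - 1))) := by
    intro k
    have h1 := sum_perm_apply_pair (fun i j => ‖x i - x j‖ ^ 2) (by simp)
      (fun h => by simpa using e.injective h : e (k, true) ≠ e (k, false))
    rw [sum_sum_norm_sub_sq x, Fintype.card_fin, ← hN] at h1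
    rw [Finset.sum_neg_distrib, ← Finset.mul_sum, ← Finset.sum_div]
    have h3 : ∑ σ : Equiv.Perm (Fin n), ‖x (σ (e (k, true))) - x (σ (e (k, false)))‖ ^ 2 =
        N * (2 * ∑ i, ‖x i - (1 / (n : ℝ)) • ∑ k, x k‖ ^ 2) / ((n : ℝ) - 1) := by
      rw [eq_div_iff hn1.ne']
      apply mul_left_cancel₀ hn0.ne'
      linarith
    rw [h3]
    ring
  rw [Finset.sum_congr rfl fun k _ => hk k, Finset.sum_const, Finset.card_univ, nsmul_eq_mul]
  field_simp

theorem integrable_norm_sub_sq {Ω : Type*} [MeasurableSpace Ω] {μ : Measure Ω}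
    [IsProbabilityMeasure μ] {E : Type*} [NormedAddCommGroup E] [MeasurableSpace E] [BorelSpace E]
    [SecondCountableTopology E] {X Y : Ω → E} {C : ℝ} (hX : Measurable X) (hY : Measurable Y)
    (hXC : ∀ᵐ ω ∂μ, ‖X ω‖ ≤ C) (hYC : ∀ᵐ ω ∂μ, ‖Y ω‖ ≤ C) :
    Integrable (fun ω => ‖X ω - Y ω‖ ^ 2) μ := by
  refine Integrable.of_bound (by fun_prop) ((C + C) ^ 2) ?_
  filter_upwards [hXC, hYC] with ω h1 h2
  rw [norm_pow, norm_norm]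
  gcongr
  exact (norm_sub_le _ _).trans (add_le_add h1 h2)

/-- In the second-order expansion of the exponential, `‖X - Y‖⁴ ≤ 4C²‖X - Y‖²`. The quadratic error
is therefore proportional to `v`, which later cancels the dependence on the variance. -/
theorem integral_exp_neg_norm_sub_sq_le {Ω : Type*} [MeasurableSpace Ω] {μ : Measure Ω}
    [IsProbabilityMeasure μ] {E : Type*} [NormedAddCommGroup E] [MeasurableSpace E] [BorelSpace E]
    [SecondCountableTopology E] {X Y : Ω → E} {v C τ : ℝ} (hX : Measurable X)
    (hY : Measurable Y) (hXC : ∀ᵐ ω ∂μ, ‖X ω‖ ≤ C) (hYC : ∀ᵐ ω ∂μ, ‖Y ω‖ ≤ C)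
    (hv : ∫ ω, ‖X ω - Y ω‖ ^ 2 ∂μ = 2 * v) (hτ : 0 ≤ τ) :
    ∫ ω, Real.exp (-(τ * (‖X ω - Y ω‖ ^ 2 / 2))) ∂μ ≤
      Real.exp (-(τ * v - τ ^ 2 * v * C ^ 2)) := by
  have i := integrable_norm_sub_sq hX hY hXC hYC
  have hle : ∀ᵐ ω ∂μ, Real.exp (-(τ * (‖X ω - Y ω‖ ^ 2 / 2))) ≤
      1 + (τ ^ 2 * C ^ 2 / 2 - τ / 2) * ‖X ω - Y ω‖ ^ 2 := by
    filter_upwards [hXC, hYC] with ω h1 h2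
    refine (exp_neg_le_quadratic (by positivity)).trans ?_
    have h3 : ‖X ω - Y ω‖ ^ 2 ≤ (C + C) ^ 2 := by
      gcongr
      exact (norm_sub_le _ _).trans (add_le_add h1 h2)
    have h4 : τ ^ 2 * ‖X ω - Y ω‖ ^ 2 * ‖X ω - Y ω‖ ^ 2 ≤
        τ ^ 2 * ‖X ω - Y ω‖ ^ 2 * (C + C) ^ 2 := by gcongr
    linarith
  refine (integral_mono_of_nonneg (ae_of_all _ fun ω => (Real.exp_pos _).le)
    ((integrable_const _).add (i.const_mul _)) hle).trans ?_
  simp only [Pi.add_apply]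
  rw [integral_add (integrable_const _) (i.const_mul _), integral_const_mul, hv]
  simp only [integral_const, probReal_univ, one_smul]
  refine le_trans (le_of_eq ?_) (Real.add_one_le_exp _)
  ring

section
variable {Ω : Type*} [MeasurableSpace Ω] {μ : Measure Ω} [IsProbabilityMeasure μ]
  {E : Type*} [NormedAddCommGroup E] [InnerProductSpace ℝ E] [CompleteSpace E]
  [MeasurableSpace E] [BorelSpace E] [SecondCountableTopology E]

theorem integral_norm_sub_sq_of_indep {X Y : Ω → E} {ν : E} {v C : ℝ} (hX : Measurable X)
    (hY : Measurable Y) (hXY : IndepFun X Y μ) (hXC : ∀ᵐ ω ∂μ, ‖X ω‖ ≤ C)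
    (hYC : ∀ᵐ ω ∂μ, ‖Y ω‖ ≤ C) (hXm : ∫ ω, X ω ∂μ = ν)
    (hXv : ∫ ω, ‖X ω - ν‖ ^ 2 ∂μ = v) (hYv : ∫ ω, ‖Y ω - ν‖ ^ 2 ∂μ = v) :
    ∫ ω, ‖X ω - Y ω‖ ^ 2 ∂μ = 2 * v := by
  have hXi : Integrable X μ := Integrable.of_bound hX.aestronglyMeasurable C hXC
  have hYi : Integrable Y μ := Integrable.of_bound hY.aestronglyMeasurable C hYC
  have hνC : ‖ν‖ ≤ C := by
    rw [← hXm]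
    simpa using norm_integral_le_of_norm_le_const hXC
  have iX := integrable_norm_sub_sq (μ := μ) hX (measurable_const (a := ν)) hXC
    (ae_of_all _ fun _ => hνC)
  have iY := integrable_norm_sub_sq (μ := μ) hY (measurable_const (a := ν)) hYC
    (ae_of_all _ fun _ => hνC)
  have hI : IndepFun (fun ω => X ω - ν) (fun ω => Y ω - ν) μ :=
    hXY.comp (φ := fun x => x - ν) (ψ := fun x => x - ν) (by fun_prop) (by fun_prop)
  have hXi' : Integrable (fun ω => X ω - ν) μ := hXi.sub (integrable_const ν)
  have hYi' : Integrable (fun ω => Y ω - ν) μ := hYi.sub (integrable_const ν)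
  have i0 : Integrable (fun ω => inner ℝ (X ω - ν) (Y ω - ν)) μ :=
    hI.integrable_bilin hXi' hYi' (innerSL ℝ)
  have e0 : ∫ ω, inner ℝ (X ω - ν) (Y ω - ν) ∂μ = 0 := by
    have h0 : ∫ ω, (X ω - ν) ∂μ = 0 := by
      rw [integral_sub hXi (integrable_const ν), hXm]
      simp
    have := hI.integral_bilin hXi' hYi' (innerSL ℝ)
    rw [h0, map_zero] at this
    exact this
  have e : ∀ ω, ‖X ω - Y ω‖ ^ 2 =
      ‖X ω - ν‖ ^ 2 - 2 * inner ℝ (X ω - ν) (Y ω - ν) + ‖Y ω - ν‖ ^ 2 := fun ω => by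
    rw [← norm_sub_sq_real, sub_sub_sub_cancel_right]
  simp only [e]
  rw [integral_add (by exact iX.sub (i0.const_mul 2)) iY, integral_sub iX (i0.const_mul 2),
    integral_const_mul, e0, hXv, hYv]
  ring

theorem integral_exp_neg_sampleVariance_le {n : ℕ} (hn : 2 ≤ n) {V : Fin n → Ω → E} {ν : E}
    {v C τ : ℝ} (hmeas : ∀ i, Measurable (V i)) (hindep : iIndepFun V μ)
    (hC : ∀ i, ∀ᵐ ω ∂μ, ‖V i ω‖ ≤ C) (hν : ∀ i, ∫ ω, V i ω ∂μ = ν)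
    (hv : ∀ i, ∫ ω, ‖V i ω - ν‖ ^ 2 ∂μ = v) (hτ : 0 ≤ τ) :
    ∫ ω, Real.exp (-(τ * ((n / 2 : ℕ) *
        ((∑ i, ‖V i ω - (1 / (n : ℝ)) • ∑ k, V k ω‖ ^ 2) / ((n : ℝ) - 1))))) ∂μ ≤
      Real.exp ((n / 2 : ℕ) * -(τ * v - τ ^ 2 * v * C ^ 2)) := by
  -- `e` selects `⌊n/2⌋` disjoint pairs of indices; for odd `n` one index is left out.
  obtain ⟨e⟩ : Nonempty (Fin (n / 2) × Bool ↪ Fin n) :=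
    Function.Embedding.nonempty_of_card_le (by simp; omega)
  let f : E → E → ℝ := fun x y => Real.exp (-(τ * (‖x - y‖ ^ 2 / 2)))
  have hfm : Measurable (Function.uncurry f) := by
    simp only [f, Function.uncurry_def]; fun_prop
  have hne : ∀ (σ : Equiv.Perm (Fin n)) k, σ (e (k, true)) ≠ σ (e (k, false)) := by
    intro σ k h
    simpa using e.injective (σ.injective h)
  have hf1 : ∀ x y, f x y ≤ 1 := fun x y => Real.exp_le_one_iff.2 (by
    have : 0 ≤ τ * (‖x - y‖ ^ 2 / 2) := by positivity
    linarith)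
  have hf0 : ∀ x y, 0 ≤ f x y := fun x y => (Real.exp_pos _).le
  have hGi : ∀ σ : Equiv.Perm (Fin n), Integrable (fun ω =>
      ∏ k, f (V (σ (e (k, true))) ω) (V (σ (e (k, false))) ω)) μ := fun σ =>
    Integrable.of_bound (Finset.measurable_prod _ fun k _ =>
        hfm.comp ((hmeas _).prodMk (hmeas _))).aestronglyMeasurable 1 (ae_of_all _ fun ω => by
      rw [Real.norm_of_nonneg (Finset.prod_nonneg fun _ _ => hf0 _ _)]
      exact Finset.prod_le_one (fun _ _ => hf0 _ _) fun _ _ => hf1 _ _)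
  have hGle : ∀ σ : Equiv.Perm (Fin n),
      ∫ ω, ∏ k, f (V (σ (e (k, true))) ω) (V (σ (e (k, false))) ω) ∂μ ≤
        Real.exp ((n / 2 : ℕ) * -(τ * v - τ ^ 2 * v * C ^ 2)) := by
    intro σ
    have h := integral_prod_pairs (μ := μ) (W := fun p => V (σ (e p))) (fun p => hmeas _)
      (hindep.precomp (g := fun p => σ (e p)) (σ.injective.comp e.injective)) hfm Finset.univ
    refine h.trans_le ?_
    rw [Real.exp_nat_mul]
    refine (Finset.prod_le_prod (fun k _ => integral_nonneg fun ω => hf0 _ _) fun k _ => ?_).trans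
      (le_of_eq ((Finset.prod_const _).trans (by rw [Finset.card_univ, Fintype.card_fin])))
    exact integral_exp_neg_norm_sub_sq_le (hmeas _) (hmeas _) (hC _) (hC _)
      (integral_norm_sub_sq_of_indep (hmeas _) (hmeas _) (hindep.indepFun (hne σ k)) (hC _) (hC _)
        (hν _) (hv _) (hv _)) hτ
  have hJ := fun ω => exp_neg_sampleVariance_le_average hn e (fun i => V i ω) τ
  simp only [Fintype.card_fin] at hJ
  generalize hN : (Fintype.card (Equiv.Perm (Fin n)) : ℝ) = N at hJ
  have hNpos : 0 < N := by rw [← hN, Nat.cast_pos]; exact Fintype.card_pos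
  refine (integral_mono_of_nonneg (ae_of_all _ fun ω => (Real.exp_pos _).le)
    (integrable_finsetSum _ fun σ _ => (hGi σ).const_mul (1 / N)) (ae_of_all _ hJ)).trans ?_
  rw [integral_finsetSum _ fun σ _ => (hGi σ).const_mul _]
  refine (Finset.sum_le_sum fun σ _ => (integral_const_mul _ _).trans_le
    (mul_le_mul_of_nonneg_left (hGle σ) (by positivity))).trans (le_of_eq ?_)
  rw [Finset.sum_const, Finset.card_univ, nsmul_eq_mul, hN, ← mul_assoc,
    mul_one_div_cancel hNpos.ne', one_mul]

theorem integral_exp_sub_sqrt_sampleVariance_le {n : ℕ} (hn : 2 ≤ n) {V : Fin n → Ω → E} {ν : E}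
    {v C θ : ℝ} (hmeas : ∀ i, Measurable (V i)) (hindep : iIndepFun V μ)
    (hC : ∀ i, ∀ᵐ ω ∂μ, ‖V i ω‖ ≤ C) (hν : ∀ i, ∫ ω, V i ω ∂μ = ν)
    (hv : ∀ i, ∫ ω, ‖V i ω - ν‖ ^ 2 ∂μ = v) (hv0 : 0 ≤ v) (hθ : 0 ≤ θ) :
    ∫ ω, Real.exp (θ * (√v -
        √((∑ i, ‖V i ω - (1 / (n : ℝ)) • ∑ k, V k ω‖ ^ 2) / ((n : ℝ) - 1)))) ∂μ ≤
      1 + Real.exp (2 * θ ^ 2 * C ^ 2 / ((n : ℝ) - 1)) := by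
  have hn1 : (0 : ℝ) < (n : ℝ) - 1 := by
    have : (2 : ℝ) ≤ n := by exact_mod_cast hn
    linarith
  set U : Ω → ℝ := fun ω => (∑ i, ‖V i ω - (1 / (n : ℝ)) • ∑ k, V k ω‖ ^ 2) / ((n : ℝ) - 1)
    with hU
  have hU0 : ∀ ω, 0 ≤ U ω := fun ω => by positivity
  have hUm : Measurable U := by fun_prop
  -- For `v = 0` the integrand is at most `1`; the general argument divides by `√v`.
  rcases hv0.eq_or_lt with h0 | h0
  · rw [← h0, Real.sqrt_zero]
    calc _ ≤ ∫ ω, (1 : ℝ) ∂μ := by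
          refine integral_mono_of_nonneg (ae_of_all _ fun ω => (Real.exp_pos _).le)
            (integrable_const _) (ae_of_all _ fun ω => Real.exp_le_one_iff.2 ?_)
          have := mul_nonneg hθ (Real.sqrt_nonneg (U ω))
          linarith
      _ ≤ _ := by
          simp only [integral_const, probReal_univ, one_smul]
          linarith [Real.exp_pos (2 * θ ^ 2 * C ^ 2 / ((n : ℝ) - 1))]
  have hs : 0 < √v := Real.sqrt_pos.2 h0
  -- `⌊n/2⌋ ≥ (n-1)/2` is the source of the factor `2/(n-1)` in the exponent.
  have hm : ((n : ℝ) - 1) / 2 ≤ (n / 2 : ℕ) := by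
    have : n ≤ 2 * (n / 2) + 1 := by omega
    have : (n : ℝ) ≤ 2 * (n / 2 : ℕ) + 1 := by exact_mod_cast this
    linarith
  have hm0 : (0 : ℝ) < (n / 2 : ℕ) := by linarith
  set m : ℝ := ((n / 2 : ℕ) : ℝ)
  -- This `τ` turns `τ m U` into `(θ/√v) U`, as `exp_sub_sqrt_le` needs; the terms linear in `θ`
  -- cancel and leave `θ²C²/m`, without `v`.
  have main := integral_exp_neg_sampleVariance_le (μ := μ) hn hmeas hindep hC hν hv
    (τ := θ / (√v * m)) (by positivity)
  have e1 : ∀ ω, θ / (√v * m) * (m * U ω) = θ / √v * U ω := fun ω => by field_simp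
  have main' : ∫ ω, Real.exp (-(θ / √v * U ω)) ∂μ ≤ Real.exp (m * -(θ / (√v * m) * v -
      (θ / (√v * m)) ^ 2 * v * C ^ 2)) := by
    refine le_trans (le_of_eq (integral_congr_ae (ae_of_all _ fun ω => ?_))) main
    exact congrArg (fun x => Real.exp (-x)) (e1 ω).symm
  have hi : Integrable (fun ω => Real.exp (-(θ / √v * U ω))) μ :=
    Integrable.of_bound (by fun_prop) 1 (ae_of_all _ fun ω => by
      rw [Real.norm_of_nonneg (Real.exp_pos _).le, Real.exp_le_one_iff]
      have : 0 ≤ θ / √v * U ω := mul_nonneg (by positivity) (hU0 ω)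
      linarith)
  calc _ ≤ ∫ ω, (1 + Real.exp (θ * √v) * Real.exp (-(θ / √v * U ω))) ∂μ :=
        integral_mono_of_nonneg (ae_of_all _ fun ω => (Real.exp_pos _).le)
          ((integrable_const _).add (hi.const_mul _))
          (ae_of_all _ fun ω => exp_sub_sqrt_le hθ hs (hU0 ω))
    _ = 1 + Real.exp (θ * √v) * ∫ ω, Real.exp (-(θ / √v * U ω)) ∂μ := by
        rw [integral_add (integrable_const _) (hi.const_mul _), integral_const_mul]
        simp
    _ ≤ 1 + Real.exp (θ * √v) * Real.exp (m * -(θ / (√v * m) * v -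
      (θ / (√v * m)) ^ 2 * v * C ^ 2)) := by gcongr
    _ ≤ _ := by
        rw [← Real.exp_add]
        gcongr
        have hvv : v = √v ^ 2 := (Real.sq_sqrt hv0).symm
        have : θ * √v + m * -(θ / (√v * m) * v - (θ / (√v * m)) ^ 2 * v * C ^ 2) =
            θ ^ 2 * C ^ 2 / m := by
          set s := √v
          rw [hvv]
          field_simp
          ring
        rw [this, div_le_div_iff₀ hm0 hn1]
        nlinarith [mul_nonneg (sq_nonneg θ) (sq_nonneg C)]

end

/-! ### Choice of scales and the empirical Bernstein inequality -/

section
variable {Ω : Type*} [MeasurableSpace Ω] {μ : Measure Ω} [IsProbabilityMeasure μ]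
  {E : Type*} [NormedAddCommGroup E] [InnerProductSpace ℝ E] [CompleteSpace E]
  [MeasurableSpace E] [BorelSpace E] [SecondCountableTopology E]

/-- Bernstein's bound in the form required by `measure_sum_pos_le`: only the scale `Λ` depends on
`v` and `C`, the bound `2 exp(-L)` does not. -/
theorem exists_scale_norm_mean_sub {n : ℕ} (hn : 2 ≤ n) {V : Fin n → Ω → E} {ν : E}
    {v C L : ℝ} (hmeas : ∀ i, Measurable (V i)) (hindep : iIndepFun V μ)
    (hC : ∀ i, ∀ᵐ ω ∂μ, ‖V i ω‖ ≤ C) (hν : ∀ i, ∫ ω, V i ω ∂μ = ν)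
    (hv : ∀ i, ∫ ω, ‖V i ω - ν‖ ^ 2 ∂μ = v) (hv0 : 0 < v) (hL : 0 < L) :
    ∃ Λ : ℝ, 0 < Λ ∧ Integrable (fun ω => Real.exp ((‖(1 / (n : ℝ)) • ∑ k, V k ω - ν‖ -
        (√(2 * L) / √n * √v + 2 * C * L / (3 * n))) / Λ)) μ ∧
      ∫ ω, Real.exp ((‖(1 / (n : ℝ)) • ∑ k, V k ω - ν‖ -
        (√(2 * L) / √n * √v + 2 * C * L / (3 * n))) / Λ) ∂μ ≤ 2 * Real.exp (-L) := by
  have hn0 : (0 : ℝ) < n := by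
    have : 0 < n := by omega
    exact_mod_cast this
  have hC0 : 0 ≤ C := by
    obtain ⟨ω, hω⟩ := (hC ⟨0, by omega⟩).exists
    exact (norm_nonneg _).trans hω
  have hνC : ‖ν‖ ≤ C := by
    rw [← hν ⟨0, by omega⟩]
    simpa using norm_integral_le_of_norm_le_const (hC ⟨0, by omega⟩)
  have hVint : ∀ i, Integrable (V i) μ := fun i =>
    Integrable.of_bound (hmeas i).aestronglyMeasurable C (hC i)
  have hs : 0 < √v := Real.sqrt_pos.2 hv0
  have hr : 0 < √(2 * L) := Real.sqrt_pos.2 (by linarith)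
  have hw : 0 < √(n : ℝ) := Real.sqrt_pos.2 hn0
  have hs2 : √v ^ 2 = v := Real.sq_sqrt hv0.le
  have hr2 : √(2 * L) ^ 2 = 2 * L := Real.sq_sqrt (by linarith)
  have hw2 : √(n : ℝ) ^ 2 = n := Real.sq_sqrt hn0.le
  have hXb : ∀ i, ∀ᵐ ω ∂μ, ‖V i ω - ν‖ ≤ 2 * C := fun i => by
    filter_upwards [hC i] with ω hω
    linarith [norm_sub_le (V i ω) ν]
  set s := √v
  set r := √(2 * L)
  set w := √(n : ℝ)
  have ha : 0 < s * w / r := by positivity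
  -- Bernstein's parameter is `1/q` with `q = 2C/3 + √(nv/(2L))`, where `2C` bounds the centred
  -- vectors. It makes the total exponent exactly `-L`.
  obtain ⟨q, hq⟩ : ∃ q, q = 2 * C / 3 + s * w / r := ⟨_, rfl⟩
  have hq0 : 0 < q := by rw [hq]; positivity
  have hden : 1 - 1 / q * (2 * C) / 3 = s * w / r / q := by
    rw [eq_div_iff hq0.ne', sub_mul]
    field_simp
    rw [hq]
    field_simp
    ring
  have hlb : 1 / q * (2 * C) < 3 := by
    have : 0 < s * w / r / q := by positivity
    linarith
  have main := integral_exp_norm_sum_le (μ := μ) (X := fun i ω => V i ω - ν) (b := 2 * C) (v := v)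
    (lam := 1 / q) (fun i => (hmeas i).sub_const ν)
    (hindep.comp (fun _ x => x - ν) fun _ => by fun_prop) hXb
    (fun i => by rw [integral_sub (hVint i) (integrable_const ν), hν i]; simp) hv
    (by positivity) hlb hv0.le
  have hexp : ∀ ω, (‖(1 / (n : ℝ)) • ∑ k, V k ω - ν‖ - (r / w * s + 2 * C * L / (3 * n))) / (q / n)
      = 1 / q * ‖∑ k, (V k ω - ν)‖ + -((r * s * w + 2 * C * L / 3) / q) := fun ω => by
    have e : ∑ k, (V k ω - ν) = (n : ℝ) • ((1 / (n : ℝ)) • ∑ k, V k ω - ν) := by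
      rw [Finset.sum_sub_distrib, Finset.sum_const, Finset.card_univ, Fintype.card_fin, smul_sub,
        smul_smul, mul_one_div_cancel hn0.ne', one_smul, Nat.cast_smul_eq_nsmul]
    rw [e, norm_smul, Real.norm_of_nonneg hn0.le, ← hw2]
    field_simp
    ring
  refine ⟨q / n, by positivity, ?_, ?_⟩
  · simp only [hexp, Real.exp_add]
    refine Integrable.mul_const ?_ _
    refine Integrable.of_bound (by fun_prop) (Real.exp (1 / q * ∑ _k : Fin n, 2 * C)) ?_
    filter_upwards [ae_all_iff.2 hXb] with ω hω
    rw [Real.norm_of_nonneg (Real.exp_pos _).le]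
    gcongr
    exact (norm_sum_le _ _).trans (Finset.sum_le_sum fun k _ => hω k)
  · simp only [hexp, Real.exp_add]
    rw [integral_mul_const]
    refine (mul_le_mul_of_nonneg_right main (Real.exp_pos _).le).trans (le_of_eq ?_)
    rw [mul_assoc, ← Real.exp_add, Fintype.card_fin, hden]
    congr 2
    rw [← hw2, ← hs2]
    have hL2 : L = r ^ 2 / 2 := by linarith
    rw [hL2]
    field_simp
    rw [hq]
    field_simp
    ring

theorem exists_scale_sub_sqrt_sampleVariance {n : ℕ} (hn : 2 ≤ n) {V : Fin n → Ω → E} {ν : E}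
    {v C L : ℝ} (hmeas : ∀ i, Measurable (V i)) (hindep : iIndepFun V μ)
    (hC : ∀ i, ∀ᵐ ω ∂μ, ‖V i ω‖ ≤ C) (hν : ∀ i, ∫ ω, V i ω ∂μ = ν)
    (hv : ∀ i, ∫ ω, ‖V i ω - ν‖ ^ 2 ∂μ = v) (hv0 : 0 ≤ v) (hC0 : 0 < C) (hL : 0 < L) :
    ∃ Λ : ℝ, 0 < Λ ∧ Integrable (fun ω => Real.exp ((√v -
        √((∑ i, ‖V i ω - (1 / (n : ℝ)) • ∑ k, V k ω‖ ^ 2) / ((n : ℝ) - 1)) -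
          2 * C * √(2 * L) / √((n : ℝ) - 1)) / Λ)) μ ∧
      ∫ ω, Real.exp ((√v -
        √((∑ i, ‖V i ω - (1 / (n : ℝ)) • ∑ k, V k ω‖ ^ 2) / ((n : ℝ) - 1)) -
          2 * C * √(2 * L) / √((n : ℝ) - 1)) / Λ) ∂μ ≤ 2 * Real.exp (-L) := by
  have hn1 : (0 : ℝ) < (n : ℝ) - 1 := by
    have : (2 : ℝ) ≤ n := by exact_mod_cast hn
    linarith
  have hr : 0 < √(2 * L) := Real.sqrt_pos.2 (by linarith)
  have hw : 0 < √((n : ℝ) - 1) := Real.sqrt_pos.2 hn1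
  have hr2 : √(2 * L) ^ 2 = 2 * L := Real.sq_sqrt (by linarith)
  have hw2 : √((n : ℝ) - 1) ^ 2 = (n : ℝ) - 1 := Real.sq_sqrt hn1.le
  set r := √(2 * L)
  set w := √((n : ℝ) - 1)
  -- This `θ` makes the moment at most `1 + exp L`, while the subtracted threshold contributes
  -- `exp(-2L)`; the product is at most `2 exp(-L)`.
  have main := integral_exp_sub_sqrt_sampleVariance_le (μ := μ) hn hmeas hindep hC hν hv hv0
    (θ := r * w / (2 * C)) (by positivity)
  have hexp : ∀ ω, (√v - √((∑ i, ‖V i ω - (1 / (n : ℝ)) • ∑ k, V k ω‖ ^ 2) / ((n : ℝ) - 1)) -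
          2 * C * r / w) / (2 * C / (r * w)) = r * w / (2 * C) * (√v -
        √((∑ i, ‖V i ω - (1 / (n : ℝ)) • ∑ k, V k ω‖ ^ 2) / ((n : ℝ) - 1))) + -(2 * L) := fun ω => by
    rw [← hr2]
    field_simp
    ring
  refine ⟨2 * C / (r * w), by positivity, ?_, ?_⟩
  · simp only [hexp, Real.exp_add]
    refine Integrable.mul_const ?_ _
    refine Integrable.of_bound (by fun_prop) (Real.exp (r * w / (2 * C) * √v))
      (ae_of_all _ fun ω => ?_)
    rw [Real.norm_of_nonneg (Real.exp_pos _).le]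
    gcongr
    exact sub_le_self _ (Real.sqrt_nonneg _)
  · simp only [hexp, Real.exp_add]
    rw [integral_mul_const]
    refine (mul_le_mul_of_nonneg_right main (Real.exp_pos _).le).trans ?_
    have e : 2 * (r * w / (2 * C)) ^ 2 * C ^ 2 / ((n : ℝ) - 1) = L := by
      rw [← hw2]
      field_simp
      linarith
    rw [e, add_mul, one_mul, ← Real.exp_add]
    have e1 : Real.exp (-(2 * L)) ≤ Real.exp (-L) := Real.exp_le_exp.2 (by linarith)
    have e2 : L + -(2 * L) = -L := by ring
    rw [e2]
    linarith

/-- Empirical Bernstein inequality for the sum of the deviations of the sample means of finitely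
many samples, each i.i.d. in a Hilbert space, but with arbitrary dependence between the samples. -/
theorem measure_sum_norm_mean_sub_gt_le {ι : Type*} [Fintype ι] {n : ℕ} (hn : 2 ≤ n)
    {V : ι → Fin n → Ω → E} {ν : ι → E} {C : ι → ℝ} {L : ℝ} (hmeas : ∀ j i, Measurable (V j i))
    (hindep : ∀ j, iIndepFun (V j) μ) (hident : ∀ j i i', IdentDistrib (V j i) (V j i') μ μ)
    (hC : ∀ j i, ∀ᵐ ω ∂μ, ‖V j i ω‖ ≤ C j) (hν : ∀ j i, ∫ ω, V j i ω ∂μ = ν j) (hL : 0 < L) :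
    μ {ω | ∑ j, (√(2 * L / n) * √((∑ i, ‖V j i ω - (1 / (n : ℝ)) • ∑ k, V j k ω‖ ^ 2) /
          ((n : ℝ) - 1)) + 14 / 3 * C j * L / ((n : ℝ) - 1)) <
        ∑ j, ‖(1 / (n : ℝ)) • ∑ k, V j k ω - ν j‖} ≤ ENNReal.ofReal (4 * Real.exp (-L)) := by
  classical
  have hn2 : (2 : ℝ) ≤ n := by exact_mod_cast hn
  have hn1 : (0 : ℝ) < (n : ℝ) - 1 := by linarith
  have hn0 : (0 : ℝ) < n := by linarith
  have hC0 : ∀ j, 0 ≤ C j := fun j => by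
    obtain ⟨ω, hω⟩ := (hC j ⟨0, by omega⟩).exists
    exact (norm_nonneg _).trans hω
  set v : ι → ℝ := fun j => ∫ ω, ‖V j ⟨0, by omega⟩ ω - ν j‖ ^ 2 ∂μ with hvdef
  have hv : ∀ j i, ∫ ω, ‖V j i ω - ν j‖ ^ 2 ∂μ = v j := fun j i =>
    ((hident j i ⟨0, by omega⟩).comp (u := fun x => ‖x - ν j‖ ^ 2) (by fun_prop)).integral_eq
  have hv0 : ∀ j, 0 ≤ v j := fun j => integral_nonneg fun ω => sq_nonneg _
  have hvanish : ∀ j, v j = 0 → ∀ i, ∀ᵐ ω ∂μ, V j i ω = ν j := by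
    intro j hj i
    have h := hv j i
    rw [hj, integral_eq_zero_iff_of_nonneg (fun ω => sq_nonneg _)
      (integrable_norm_sub_sq (hmeas j i) measurable_const (hC j i)
        (ae_of_all _ fun _ => by
          rw [← hν j i]
          simpa using norm_integral_le_of_norm_le_const (hC j i)))] at h
    filter_upwards [h] with ω hω
    simpa [sub_eq_zero] using hω
  have hCpos : ∀ j, 0 < v j → 0 < C j := by
    intro j hj
    refine (hC0 j).lt_of_ne fun h => hj.ne' ?_
    have hz : ∀ᵐ ω ∂μ, V j ⟨0, by omega⟩ ω = 0 := by
      filter_upwards [hC j ⟨0, by omega⟩] with ω hω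
      exact norm_le_zero_iff.1 (hω.trans h.symm.le)
    have hν0 : ν j = 0 := by rw [← hν j ⟨0, by omega⟩, integral_eq_zero_of_ae hz]
    refine integral_eq_zero_of_ae ?_
    filter_upwards [hz] with ω hω
    simp [hω, hν0]
  set D : ι → Ω → ℝ := fun j ω => ‖(1 / (n : ℝ)) • ∑ k, V j k ω - ν j‖
  set R : ι → Ω → ℝ := fun j ω =>
    √((∑ i, ‖V j i ω - (1 / (n : ℝ)) • ∑ k, V j k ω‖ ^ 2) / ((n : ℝ) - 1))
  set β : ι → ℝ := fun j => √(2 * L) / √n * √(v j) + 2 * C j * L / (3 * n)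
  set t : ι → ℝ := fun j => 2 * C j * √(2 * L) / √((n : ℝ) - 1)
  have hD0 : ∀ j, v j = 0 → ∀ᵐ ω ∂μ, D j ω = 0 := by
    intro j hj
    filter_upwards [ae_all_iff.2 (hvanish j hj)] with ω hω
    simp only [D, hω, Finset.sum_const, Finset.card_univ, Fintype.card_fin]
    rw [← Nat.cast_smul_eq_nsmul ℝ, smul_smul, one_div_mul_cancel hn0.ne', one_smul, sub_self,
      norm_zero]
  have hneg : ∀ {Z : ι → Ω → ℝ}, (∀ j, v j = 0 → ∀ᵐ ω ∂μ, Z j ω ≤ 0) →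
      μ {ω | 0 < ∑ j, Z j ω} ≤ μ {ω | 0 < ∑ j with 0 < v j, Z j ω} := by
    intro Z hZ
    refine measure_mono_ae ?_
    have : ∀ᵐ ω ∂μ, ∀ j, v j = 0 → Z j ω ≤ 0 := ae_all_iff.2 fun j => by
      by_cases h : v j = 0
      · filter_upwards [hZ j h] with ω hω _ using hω
      · exact ae_of_all _ fun ω h' => absurd h' h
    filter_upwards [this] with ω hω hpos
    have hpos' : 0 < ∑ j, Z j ω := hpos
    rw [← Finset.sum_filter_add_sum_filter_not Finset.univ (fun j => 0 < v j)] at hpos'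
    have : ∑ j with ¬ 0 < v j, Z j ω ≤ 0 := Finset.sum_nonpos fun j hj =>
      hω j (le_antisymm (not_lt.1 (Finset.mem_filter.1 hj).2) (hv0 j))
    show 0 < ∑ j with 0 < v j, Z j ω
    linarith
  have hmean : μ {ω | 0 < ∑ j, (D j ω - β j)} ≤ ENNReal.ofReal (2 * Real.exp (-L)) := by
    refine (hneg fun j hj => ?_).trans ?_
    · filter_upwards [hD0 j hj] with ω hω
      have : 0 ≤ β j := by have := hC0 j; positivity
      linarith
    · have hex : ∀ j, ∃ Λ, 0 < v j → 0 < Λ ∧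
          Integrable (fun ω => Real.exp ((D j ω - β j) / Λ)) μ ∧
          ∫ ω, Real.exp ((D j ω - β j) / Λ) ∂μ ≤ 2 * Real.exp (-L) := fun j => by
        by_cases h : 0 < v j
        · obtain ⟨Λ, hΛ⟩ := exists_scale_norm_mean_sub (μ := μ) hn (hmeas j) (hindep j) (hC j)
            (hν j) (hv j) h hL
          exact ⟨Λ, fun _ => hΛ⟩
        · exact ⟨0, fun h' => absurd h' h⟩
      choose Λ hΛ using hex
      exact measure_sum_pos_le _ (fun j hj => (hΛ j (Finset.mem_filter.1 hj).2).1)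
        (fun j hj => (hΛ j (Finset.mem_filter.1 hj).2).2.1)
        (fun j hj => (hΛ j (Finset.mem_filter.1 hj).2).2.2)
  have hvar : μ {ω | 0 < ∑ j, (√(v j) - R j ω - t j)} ≤ ENNReal.ofReal (2 * Real.exp (-L)) := by
    refine (hneg fun j hj => ae_of_all _ fun ω => ?_).trans ?_
    · have h1 : 0 ≤ R j ω := Real.sqrt_nonneg _
      have h2 : 0 ≤ t j := by have := hC0 j; positivity
      rw [hj, Real.sqrt_zero]
      linarith
    · have hex : ∀ j, ∃ Λ, 0 < v j → 0 < Λ ∧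
          Integrable (fun ω => Real.exp ((√(v j) - R j ω - t j) / Λ)) μ ∧
          ∫ ω, Real.exp ((√(v j) - R j ω - t j) / Λ) ∂μ ≤ 2 * Real.exp (-L) := fun j => by
        by_cases h : 0 < v j
        · obtain ⟨Λ, hΛ⟩ := exists_scale_sub_sqrt_sampleVariance (μ := μ) hn (hmeas j) (hindep j)
            (hC j) (hν j) (hv j) h.le (hCpos j h) hL
          exact ⟨Λ, fun _ => hΛ⟩
        · exact ⟨0, fun h' => absurd h' h⟩
      choose Λ hΛ using hex
      exact measure_sum_pos_le _ (fun j hj => (hΛ j (Finset.mem_filter.1 hj).2).1)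
        (fun j hj => (hΛ j (Finset.mem_filter.1 hj).2).2.1)
        (fun j hj => (hΛ j (Finset.mem_filter.1 hj).2).2.2)
  have hsplit : √(2 * L / n) = √(2 * L) / √n := Real.sqrt_div (by linarith) _
  -- `14/3 = 4 + 2/3`: the estimation error of `σ` contributes `4`, Bernstein's linear term `2/3`.
  have hcoef : ∀ j, √(2 * L) / √n * t j + 2 * C j * L / (3 * n) ≤
      14 / 3 * C j * L / ((n : ℝ) - 1) := by
    intro j
    have hw : 0 < √((n : ℝ) - 1) := Real.sqrt_pos.2 hn1
    have hwn : √((n : ℝ) - 1) ≤ √n := Real.sqrt_le_sqrt (by linarith)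
    have hw2 : √((n : ℝ) - 1) ^ 2 = (n : ℝ) - 1 := Real.sq_sqrt hn1.le
    have hr2 : √(2 * L) ^ 2 = 2 * L := Real.sq_sqrt (by linarith)
    have hCj := hC0 j
    have h1 : √(2 * L) / √n * t j ≤ 4 * C j * L / ((n : ℝ) - 1) := by
      calc √(2 * L) / √n * t j ≤ √(2 * L) / √((n : ℝ) - 1) * t j := by gcongr
        _ = 2 * C j * √(2 * L) ^ 2 / √((n : ℝ) - 1) ^ 2 := by simp only [t]; field_simp
        _ = _ := by rw [hw2, hr2]; ring
    have h2 : 2 * C j * L / (3 * n) ≤ 2 * C j * L / (3 * ((n : ℝ) - 1)) := by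
      gcongr
      linarith
    have h3 : 4 * C j * L / ((n : ℝ) - 1) + 2 * C j * L / (3 * ((n : ℝ) - 1)) =
        14 / 3 * C j * L / ((n : ℝ) - 1) := by
      field_simp
      ring
    linarith
  have hsub : {ω | ∑ j, (√(2 * L / n) * R j ω + 14 / 3 * C j * L / ((n : ℝ) - 1)) < ∑ j, D j ω} ⊆
      {ω | 0 < ∑ j, (D j ω - β j)} ∪ {ω | 0 < ∑ j, (√(v j) - R j ω - t j)} := by
    intro ω hω
    by_contra hcon
    simp only [Set.mem_union, Set.mem_ofPred_eq, not_or, not_lt] at hcon hω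
    have h1 := mul_le_mul_of_nonneg_left hcon.2 (show 0 ≤ √(2 * L) / √n by positivity)
    rw [mul_zero, Finset.mul_sum] at h1
    have h2 : ∑ j, D j ω ≤ ∑ j, (√(2 * L / n) * R j ω + 14 / 3 * C j * L / ((n : ℝ) - 1)) := by
      calc ∑ j, D j ω = ∑ j, (D j ω - β j) + ∑ j, √(2 * L) / √n * (√(v j) - R j ω - t j) +
            ∑ j, (√(2 * L) / √n * R j ω + (√(2 * L) / √n * t j + 2 * C j * L / (3 * n))) := by
            rw [← Finset.sum_add_distrib, ← Finset.sum_add_distrib]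
            refine Finset.sum_congr rfl fun j _ => ?_
            simp only [β]
            ring
        _ ≤ 0 + 0 + ∑ j, (√(2 * L / n) * R j ω + 14 / 3 * C j * L / ((n : ℝ) - 1)) := by
            rw [hsplit]
            gcongr with j
            · exact hcon.1
            · exact hcoef j
        _ = _ := by ring
    linarith
  refine (measure_mono hsub).trans ((measure_union_le _ _).trans ((add_le_add hmean hvar).trans ?_))
  rw [← ENNReal.ofReal_add (by positivity) (by positivity)]
  exact ENNReal.ofReal_le_ofReal (by linarith)

end

/-! ### Comparison of constants and the theorem -/

/-- After squaring, this is `n ≤ 2(n - 1)`, the place where `n ≥ 2` is sharp. -/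
theorem sqrt_mul_sqrt_le_two_mul_sqrt_div {n : ℕ} (hn : 2 ≤ n) {S L : ℝ} (hS : 0 ≤ S) (hL : 0 ≤ L) :
    √(2 * L / n) * √(S / ((n : ℝ) - 1)) ≤ 2 * √(S * L) / n := by
  have hn2 : (2 : ℝ) ≤ n := by exact_mod_cast hn
  have hn1 : (0 : ℝ) < (n : ℝ) - 1 := by linarith
  have hn0 : (0 : ℝ) < n := by linarith
  rw [← Real.sqrt_mul (by positivity)]
  refine Real.sqrt_le_iff.2 ⟨by positivity, ?_⟩
  rw [div_pow, mul_pow, Real.sq_sqrt (by positivity), div_mul_div_comm,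
    div_le_div_iff₀ (by positivity) (by positivity)]
  have h0 : 0 ≤ S * L := by positivity
  have h1 : 0 ≤ (n : ℝ) * ((n : ℝ) - 2) := mul_nonneg hn0.le (by linarith)
  nlinarith [mul_nonneg h0 h1]

theorem sqrt_mul_sqrt_le_sqrt_div_sub_one {n : ℕ} (hn : 2 ≤ n) {S L : ℝ} (hS : 0 ≤ S)
    (hL : 0 ≤ L) : √(2 * L / n) * √(S / ((n : ℝ) - 1)) ≤ √(2 * S * L) / ((n : ℝ) - 1) := by
  have hn2 : (2 : ℝ) ≤ n := by exact_mod_cast hn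
  have hn1 : (0 : ℝ) < (n : ℝ) - 1 := by linarith
  have hn0 : (0 : ℝ) < n := by linarith
  rw [← Real.sqrt_mul (by positivity)]
  refine Real.sqrt_le_iff.2 ⟨by positivity, ?_⟩
  rw [div_pow, Real.sq_sqrt (by positivity), div_mul_div_comm, pow_two]
  calc _ = 2 * S * L / (n * ((n : ℝ) - 1)) := by ring
    _ ≤ _ := by gcongr; linarith

theorem four_mul_exp_neg_log_div {a δ : ℝ} (ha : 0 < a) (hδ : 0 < δ) :
    4 * Real.exp (-Real.log (a / δ)) = 4 / a * δ := by
  rw [← Real.log_inv, Real.exp_log (by positivity)]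
  field_simp

theorem mainTheorem5 {Ω : Type*} [MeasurableSpace Ω] (μ : Measure Ω) [IsProbabilityMeasure μ]
    (n d : ℕ) (hn : 2 ≤ n) (hd : 1 ≤ d)
    (V : Fin n → Ω → Fin d → ℝ)
    (hmeas : ∀ i, Measurable (V i))
    (hindep : iIndepFun V μ)
    (hident : ∀ i i', IdentDistrib (V i) (V i') μ μ)
    (ν : Fin d → ℝ) (hν : ∀ i, ν = ∫ ω, V i ω ∂μ) :
    (∀ C : ℝ, (∀ i, ∀ᵐ ω ∂μ, vecNorm 2 (V i ω) ≤ C) →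
      ∀ δ : ℝ, 0 < δ → δ < 1 →
        μ {ω | vecNorm 2 (sampleMean V ω - ν) >
            2 * √((∑ i, vecNorm 2 (V i ω - sampleMean V ω) ^ 2) * Real.log (6 / δ)) / (n : ℝ)
              + 10 * C * Real.log (6 / δ) / ((n : ℝ) - 1)} ≤ ENNReal.ofReal δ) ∧
    (∀ C : Fin d → ℝ, (∀ i, ∀ᵐ ω ∂μ, ∀ j, |V i ω j| ≤ C j) →
      ∀ δ : ℝ, 0 < δ → δ < 1 →
        (μ {ω | vecNorm ∞ (sampleMean V ω - ν) >
            ⨆ j : Fin d,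
              (√(2 * (∑ i, (V i ω j - sampleMean V ω j) ^ 2) * Real.log (4 * (d : ℝ) / δ))
                  / ((n : ℝ) - 1)
                + 14 * C j * Real.log (4 * (d : ℝ) / δ) / (3 * ((n : ℝ) - 1)))}
          ≤ ENNReal.ofReal δ) ∧
        (μ {ω | vecNorm 1 (sampleMean V ω - ν) >
            ∑ j : Fin d,
              (9 / 4 * √(2 * (∑ i, (V i ω j - sampleMean V ω j) ^ 2) * Real.log (30 / δ))
                  / ((n : ℝ) - 1)
                + 25 * C j * Real.log (30 / δ) / ((n : ℝ) - 1))}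
          ≤ ENNReal.ofReal δ)) := by
  have hn2 : (2 : ℝ) ≤ n := by exact_mod_cast hn
  have hn1 : (0 : ℝ) < (n : ℝ) - 1 := by linarith
  have hd1 : (1 : ℝ) ≤ d := by exact_mod_cast hd
  refine ⟨fun C hC δ hδ hδ1 => ?_, fun C hC δ hδ hδ1 => ?_⟩
  · have hL : 0 < Real.log (6 / δ) := Real.log_pos (by rw [lt_div_iff₀ hδ]; linarith)
    have hC0 : 0 ≤ C := by
      obtain ⟨ω, hω⟩ := (hC ⟨0, by omega⟩).exists
      exact (norm_nonneg _).trans hω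
    have hX : ∀ i, Measurable fun ω => (WithLp.toLp 2 (V i ω) : EuclideanSpace ℝ (Fin d)) :=
      fun i => (WithLp.measurable_toLp 2 _).comp (hmeas i)
    -- A single sample in Euclidean space; `14/3 ≤ 10` and `4/6 ≤ 1` leave room in the stated
    -- constants.
    have hmain := measure_sum_norm_mean_sub_gt_le (μ := μ) (ι := Unit) hn
      (V := fun _ i ω => (WithLp.toLp 2 (V i ω) : EuclideanSpace ℝ (Fin d)))
      (ν := fun _ => WithLp.toLp 2 ν) (C := fun _ => C) (fun _ i => hX i)
      (fun _ => hindep.comp (fun _ => WithLp.toLp 2) fun _ => WithLp.measurable_toLp 2 _)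
      (fun _ i i' => (hident i i').comp (WithLp.measurable_toLp 2 _)) (fun _ i => hC i)
      (fun _ i => by
        rw [hν i]
        exact (PiLp.continuousLinearEquiv 2 ℝ (fun _ : Fin d => ℝ)).symm.integral_comp_comm _) hL
    simp only [Finset.univ_unique, Finset.sum_singleton] at hmain
    refine (measure_mono fun ω hω => ?_).trans (hmain.trans (ENNReal.ofReal_le_ofReal ?_))
    · have e : (1 / (n : ℝ)) • ∑ k, (WithLp.toLp 2 (V k ω) : EuclideanSpace ℝ (Fin d)) =
          WithLp.toLp 2 (sampleMean V ω) := by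
        rw [sampleMean, WithLp.toLp_smul, WithLp.toLp_sum]
      simp only [Set.mem_ofPred_eq, e, ← WithLp.toLp_sub]
      refine lt_of_le_of_lt (add_le_add (sqrt_mul_sqrt_le_two_mul_sqrt_div hn
        (Finset.sum_nonneg fun _ _ => sq_nonneg _) hL.le) ?_) hω
      gcongr
      linarith
    · rw [four_mul_exp_neg_log_div (by norm_num) hδ]
      linarith
  have hVj : ∀ i j, Measurable fun ω => V i ω j := fun i j =>
    (measurable_pi_apply j).comp (hmeas i)
  have hb : ∀ j i, ∀ᵐ ω ∂μ, ‖V i ω j‖ ≤ C j := fun j i => (hC i).mono fun ω hω => hω j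
  have hC0 : ∀ j, 0 ≤ C j := fun j => by
    obtain ⟨ω, hω⟩ := (hb j ⟨0, by omega⟩).exists
    exact (norm_nonneg _).trans hω
  have hνj : ∀ j i, ∫ ω, V i ω j ∂μ = ν j := fun j i => by
    rw [hν i, eval_integral fun j =>
      Integrable.of_bound (hVj i j).aestronglyMeasurable (C j) (hb j i)]
  have hind : ∀ j, iIndepFun (fun i ω => V i ω j) μ := fun j =>
    hindep.comp (fun _ x => x j) fun _ => measurable_pi_apply j
  have hid : ∀ j i i', IdentDistrib (fun ω => V i ω j) (fun ω => V i' ω j) μ μ := fun j i i' =>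
    (hident i i').comp (measurable_pi_apply j)
  have hm : ∀ ω j, (1 / (n : ℝ)) • ∑ k, V k ω j = sampleMean V ω j := fun ω j => by
    simp [sampleMean]
  refine ⟨?_, ?_⟩
  · have hL : 0 < Real.log (4 * d / δ) := Real.log_pos (by rw [lt_div_iff₀ hδ]; linarith)
    set L := Real.log (4 * d / δ) with hLdef
    -- One real sample per coordinate; `4 exp(-L) = δ/d` is exactly what the union bound over `d`
    -- coordinates consumes.
    have hone : ∀ j, μ {ω | √(2 * (∑ i, (V i ω j - sampleMean V ω j) ^ 2) * L) / ((n : ℝ) - 1)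
        + 14 * C j * L / (3 * ((n : ℝ) - 1)) < |sampleMean V ω j - ν j|} ≤
        ENNReal.ofReal (δ / d) := by
      intro j
      have hmain := measure_sum_norm_mean_sub_gt_le (μ := μ) (ι := Unit) hn
        (V := fun _ i ω => V i ω j) (ν := fun _ => ν j) (C := fun _ => C j) (fun _ i => hVj i j)
        (fun _ => hind j) (fun _ => hid j) (fun _ => hb j) (fun _ => hνj j) hL
      simp only [Finset.univ_unique, Finset.sum_singleton, hm, Real.norm_eq_abs, sq_abs] at hmain
      refine (measure_mono fun ω hω => ?_).trans (hmain.trans (ENNReal.ofReal_le_ofReal ?_))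
      · refine lt_of_le_of_lt (add_le_add (sqrt_mul_sqrt_le_sqrt_div_sub_one hn
          (Finset.sum_nonneg fun _ _ => sq_nonneg _) hL.le) (le_of_eq ?_)) hω
        field_simp
      · rw [hLdef, four_mul_exp_neg_log_div (by positivity) hδ]
        refine le_of_eq ?_
        field_simp
    calc _ ≤ μ (⋃ j, {ω | √(2 * (∑ i, (V i ω j - sampleMean V ω j) ^ 2) * L) / ((n : ℝ) - 1)
        + 14 * C j * L / (3 * ((n : ℝ) - 1)) < |sampleMean V ω j - ν j|}) := by
          refine measure_mono fun ω hω => ?_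
          by_contra hcon
          simp only [Set.mem_iUnion, Set.mem_ofPred_eq, not_exists, not_lt] at hcon
          rw [Set.mem_ofPred_eq] at hω
          refine (not_le.2 hω) ?_
          have : Nonempty (Fin d) := ⟨⟨0, by omega⟩⟩
          rw [vecNorm, PiLp.norm_eq_ciSup]
          exact ciSup_mono (Set.finite_range _).bddAbove hcon
      _ ≤ ∑ j, _ := measure_iUnion_fintype_le _ _
      _ ≤ ∑ _j : Fin d, ENNReal.ofReal (δ / d) := Finset.sum_le_sum fun j _ => hone j
      _ = _ := by
          rw [Finset.sum_const, Finset.card_univ, Fintype.card_fin, nsmul_eq_mul,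
            ← ENNReal.ofReal_natCast, ← ENNReal.ofReal_mul (by positivity),
            mul_div_cancel₀ _ (by positivity)]
  · have hL : 0 < Real.log (30 / δ) := Real.log_pos (by rw [lt_div_iff₀ hδ]; linarith)
    -- All coordinates are treated at once as dependent real samples, so the logarithm carries no
    -- `d`. The constants `9/4`, `25` and `30` are larger than this argument needs.
    have hmain := measure_sum_norm_mean_sub_gt_le (μ := μ) hn
      (V := fun j i ω => V i ω j) (ν := ν) (C := C) (fun j i => hVj i j)
      hind hid hb hνj hL
    simp only [hm, Real.norm_eq_abs, sq_abs] at hmain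
    refine (measure_mono fun ω hω => ?_).trans (hmain.trans (ENNReal.ofReal_le_ofReal ?_))
    · have hω' : _ < vecNorm 1 (sampleMean V ω - ν) := hω
      rw [vecNorm, PiLp.norm_eq_of_L1] at hω'
      refine lt_of_le_of_lt (Finset.sum_le_sum fun j _ => add_le_add
        ((sqrt_mul_sqrt_le_sqrt_div_sub_one hn
          (Finset.sum_nonneg fun _ _ => sq_nonneg _) hL.le).trans ?_) ?_) hω'
      · gcongr
        exact le_mul_of_one_le_left (Real.sqrt_nonneg _) (by norm_num)
      · have := hC0 j
        gcongr
        norm_num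
    · rw [four_mul_exp_neg_log_div (by norm_num) hδ]
      linarith
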